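/- Let $X$ be a measurable space, let $p_s$ and $p_t$ be probability measures on $X$ (the source and target distributions), and let $h\colon X\to[0,1]$ be measurable (the true labeling function). Let $H$ be a class of measurable prediction functions $f\colon X\to[0,1]$ with finite VC dimension $d$, i.e. the family of sets $\{x : f(x)\ge t\}$ with $f\in H$, $0<t<1$, has VC dimension $d$ (for $\{0,1\}$-valued $f$ this is the usual VC dimension of a class of binary classifiers). Put $$e_s(f)=\mathbb E_{x\sim p_s}|h(x)-f(x)|,\qquad e_t(f)=\mathbb E_{x\sim p_t}|h(x)-f(x)|,$$ $$D_f(p_s,p_t)=\mathbb E_{x\sim p_t}|h(x)-f(x)|-\mathbb E_{x\sim p_s}|h(x)-f(x)|,\qquad \Omega=\inf_{f\in H}\,[e_s(f)+e_t(f)].$$ Assume, as usual in empirical process theory, that the class of losses $\{|h-f| : f\in H\}$ is $p_s$-measurable: for all $m$ and $c\in\mathbb R^m$ the function $(x_1,\dots,x_m)\mapsto\sup_{f\in H}\bigl|\sum_i c_i|h(x_i)-f(x_i)|\bigr|$ is measurable for the completion of $p_s^{m}$. Let $n\ge 1$, $d\le 2n$, $0<\delta<1$, let $x_1,\dots,x_n$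 be drawn independently from $p_s$, and let $\hat e_s(f)=\frac1n\sum_{i=1}^n|h(x_i)-f(x_i)|$. Then with probability at least $1-\delta$, simultaneously for all $f\in H$, $$e_t(f)\le \hat e_s(f)+\sqrt{\frac4n\Bigl(d\log\frac{2en}{d}+\log\frac4\delta\Bigr)}+D_f(p_s,p_t)+\Omega ,$$ where $e$ in $2en$ is the base of the natural logarithm and $d\log\frac{2en}{d}$ is read as $0$ if $d=0$. -/

import Mathlib

open MeasureTheory

namespace TransferBound

variable {X : Type*}

/-- A family `C` of subsets of `X` shatters the finite set `S` if every subset of `S` is the trace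
on `S` of a member of `C`. -/
def Shatters (C : Set (Set X)) (S : Finset X) : Prop :=
  ∀ T : Finset X, T ⊆ S → ∃ A ∈ C, (S : Set X) ∩ A = (T : Set X)

/-- The Vapnik-Chervonenkis dimension of a family of sets: the supremum, possibly infinite, of the
cardinalities of the finite sets that it shatters. -/
noncomputable def setVCDim (C : Set (Set X)) : ℕ∞ :=
  ⨆ (S : Finset X) (_ : Shatters C S), (S.card : ℕ∞)

/-- The Vapnik-Chervonenkis dimension of a class of `[0,1]`-valued functions, following Vapnik: the
VC dimension of the sets `{x | t ≤ f x}` with `f` in the class and `0 < t < 1`.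
If the functions take only the values `0` and `1`, these are the sets `{x | f x = 1}`, and this is
the usual VC dimension of a class of binary classifiers. -/
noncomputable def vcDim (H : Set (X → ℝ)) : ℕ∞ :=
  setVCDim {A : Set X | ∃ f ∈ H, ∃ t ∈ Set.Ioo (0 : ℝ) 1, A = {x | t ≤ f x}}

/-- The loss `l(x) = |h(x) - f(x)|` of the prediction function `f`, where `h` is the true labeling
function. -/
def loss (h f : X → ℝ) (x : X) : ℝ := |h x - f x|

/-- The empirical error of `f` on the sample `x₁, …, xₙ`. -/
noncomputable def empiricalError (h f : X → ℝ) {n : ℕ} (x : Fin n → X) : ℝ :=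
  (1 / (n : ℝ)) * ∑ i, loss h f (x i)

variable [MeasurableSpace X]

/-- The expected error of `f` in the domain with distribution `p`. -/
noncomputable def expectedError (p : Measure X) (h f : X → ℝ) : ℝ := ∫ x, loss h f x ∂p

/-- The discrepancy between source and target for `f`: the expectation of the loss
under the target distribution minus the one under the source distribution. -/
noncomputable def discrepancy (ps pt : Measure X) (h f : X → ℝ) : ℝ :=
  (∫ x, loss h f x ∂pt) - ∫ x, loss h f x ∂ps

/-- The smallest combined error `inf_{f ∈ H} [e_s(f) + e_t(f)]`. -/
noncomputable def combinedError (ps pt : Measure X) (h : X → ℝ) (H : Set (X → ℝ)) : ℝ :=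
  ⨅ f : H, (expectedError ps h f + expectedError pt h f)

/-- `F` is a `p`-measurable class, as in empirical process theory: its members are measurable, and
for every `m` and all real `c₁, …, cₘ` the function
`(x₁, …, xₘ) ↦ sup_{g ∈ F} |∑ᵢ cᵢ g(xᵢ)|` is measurable for the completion of the product measure
`p^m`. Every countable class of measurable functions with pointwise bounds is of this kind. -/
def IsMeasurableClass (p : Measure X) (F : Set (X → ℝ)) : Prop :=
  (∀ g ∈ F, Measurable g) ∧
    ∀ (m : ℕ) (c : Fin m → ℝ),
      AEMeasurable (fun x : Fin m → X => ⨆ g : F, |∑ i, c i * (g : X → ℝ) (x i)|)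
        (Measure.pi fun _ : Fin m => p)

end TransferBound

/-! Since `discrepancy` is e_t − e_s and Ω ≥ 0, it suffices to show that e_s(f) ≤ ê_s(f) + r
uniformly over H, with r the square root term. This is Vapnik–Chervonenkis symmetrization, run on
exponential moments. By Jensen over a ghost sample y, exp(rn(e_s − ê_s)) is at most Q(x) = E_y exp(r
· sup of the double-sample differences). Swapping x_i with y_i preserves the law, so random signs
may be inserted. For a fixed double sample, the layer-cake formula and Jensen reduce real-valued
losses to indicators at a level t. There only finitely many traces occur, at most N by Sauer–Shelah,
and each sign sum is sub-Gaussian. Hence E Q ≤ 2N exp(nr²/2), and Markov at level exp(nr²) concludes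
(`exists_uniform_bound`). -/

namespace TransferBound

/-- The real number `1` for `true` and `-1` for `false`. -/
def signOf (b : Bool) : ℝ := if b then 1 else -1

/-- The indicator of a proposition, as a real number. -/
noncomputable def ind (p : Prop) : ℝ := open Classical in if p then 1 else 0

theorem ind_nonneg (p : Prop) : 0 ≤ ind p := by unfold ind; split_ifs <;> norm_num

theorem ind_le_one (p : Prop) : ind p ≤ 1 := by unfold ind; split_ifs <;> norm_num

theorem measurable_ind_le (a : ℝ) : Measurable fun t : ℝ => ind (t ≤ a) := by
  classical
  have : (fun t : ℝ => ind (t ≤ a)) = (Set.Iic a).indicator fun _ => 1 := by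
    ext t; simp [ind, Set.indicator]
  rw [this]
  exact measurable_const.indicator measurableSet_Iic

theorem abs_ind_sub_mem (p q : Prop) : |ind p - ind q| ∈ Set.Icc (0 : ℝ) 1 :=
  ⟨abs_nonneg _, abs_le.2 ⟨by linarith [ind_nonneg p, ind_le_one q],
    by linarith [ind_nonneg q, ind_le_one p]⟩⟩

/-! ### Exponential moments of sign sums -/

theorem sum_exp_signs_le {n : ℕ} (a : Fin n → ℝ) (ha : ∀ i, |a i| ≤ 1) (r : ℝ) :
    ∑ s : Fin n → Bool, Real.exp (r * ∑ i, signOf (s i) * a i)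
      ≤ 2 ^ n * Real.exp (n * (r ^ 2 / 2)) := by
  have h1 : ∀ s : Fin n → Bool, Real.exp (r * ∑ i, signOf (s i) * a i)
      = ∏ i, Real.exp (r * (signOf (s i) * a i)) := fun s => by
    rw [Finset.mul_sum, Real.exp_sum]
  simp_rw [h1]
  rw [← Fintype.prod_sum (fun i b => Real.exp (r * (signOf b * a i)))]
  have h2 : ∀ i, ∑ b, Real.exp (r * (signOf b * a i)) ≤ 2 * Real.exp (r ^ 2 / 2) := fun i => by
    have h3 : ∑ b, Real.exp (r * (signOf b * a i)) = 2 * Real.cosh (r * a i) := by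
      simp [signOf, Real.cosh_eq]; ring
    rw [h3]
    have h4 : (r * a i) ^ 2 ≤ r ^ 2 := by
      rw [mul_pow]
      have : a i ^ 2 ≤ 1 := (sq_le_one_iff_abs_le_one _).2 (ha i)
      nlinarith [sq_nonneg r]
    have := Real.cosh_le_exp_half_sq (r * a i)
    have h5 : Real.exp ((r * a i) ^ 2 / 2) ≤ Real.exp (r ^ 2 / 2) := Real.exp_le_exp.2 (by linarith)
    linarith
  calc ∏ i, ∑ b, Real.exp (r * (signOf b * a i))
      ≤ ∏ _i : Fin n, 2 * Real.exp (r ^ 2 / 2) :=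
        Finset.prod_le_prod (fun i _ => Finset.sum_nonneg fun _ _ => (Real.exp_pos _).le)
          fun i _ => h2 i
    _ = _ := by simp [mul_pow, ← Real.exp_nat_mul]

theorem sum_exp_abs_signs_le {n : ℕ} (a : Fin n → ℝ) (ha : ∀ i, |a i| ≤ 1) (r : ℝ) :
    ∑ s : Fin n → Bool, Real.exp (r * |∑ i, signOf (s i) * a i|)
      ≤ 2 * (2 ^ n * Real.exp (n * (r ^ 2 / 2))) := by
  have h1 := sum_exp_signs_le a ha r
  have h2 := sum_exp_signs_le a ha (-r)
  rw [neg_sq] at h2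
  have h3 : ∀ s : Fin n → Bool, Real.exp (r * |∑ i, signOf (s i) * a i|)
      ≤ Real.exp (r * ∑ i, signOf (s i) * a i) + Real.exp (-r * ∑ i, signOf (s i) * a i) := by
    intro s
    rcases abs_choice (∑ i, signOf (s i) * a i) with h | h <;> rw [h]
    · linarith [Real.exp_pos (-r * ∑ i, signOf (s i) * a i)]
    · rw [mul_neg, ← neg_mul]; linarith [Real.exp_pos (r * ∑ i, signOf (s i) * a i)]
  have h4 := Finset.sum_le_sum fun s (_ : s ∈ Finset.univ) => h3 s
  rw [Finset.sum_add_distrib] at h4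
  linarith

/-- Layer cake: for a ≤ b the integrand is the indicator of (a, b]. -/
theorem abs_sub_eq_integral_ind {a b : ℝ} (ha : a ∈ Set.Icc (0 : ℝ) 1) (hb : b ∈ Set.Icc (0 : ℝ) 1) :
    |a - b| = ∫ t in Set.Ioo (0 : ℝ) 1, |ind (t ≤ a) - ind (t ≤ b)| := by
  wlog hab : a ≤ b generalizing a b
  · rw [abs_sub_comm, this hb ha (by linarith)]
    simp_rw [abs_sub_comm]
  have h1 : (fun t : ℝ => |ind (t ≤ a) - ind (t ≤ b)|) = (Set.Ioc a b).indicator fun _ => 1 := by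
    ext t
    by_cases h1 : t ≤ a
    · simp [ind, h1, h1.trans hab, Set.indicator]
    · by_cases h2 : t ≤ b <;> simp [ind, h1, h2, Set.indicator, not_le.1 h1]
  rw [← integral_Ioc_eq_integral_Ioo, h1, integral_indicator measurableSet_Ioc,
    Measure.restrict_restrict measurableSet_Ioc, Set.inter_eq_left.2 (Set.Ioc_subset_Ioc ha.1 hb.2)]
  simp [abs_sub_comm a b, abs_of_nonneg (sub_nonneg.2 hab), hab]

/-! ### Traces and the Sauer–Shelah bound -/

/-- The traces of a family of sets along a map from a finite type. -/
noncomputable def traces {J X : Type*} [Fintype J] (C : Set (Set X)) (z : J → X) :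
    Finset (Finset J) :=
  open Classical in Finset.univ.filter fun T => ∃ A ∈ C, (T : Set J) = z ⁻¹' A

theorem card_le_of_traces_shatters {J X : Type*} [Fintype J] [DecidableEq J] {C : Set (Set X)}
    {d : ℕ} (hd : setVCDim C ≤ d) (z : J → X) {s : Finset J} (hs : (traces C z).Shatters s) :
    s.card ≤ d := by
  classical
  have hmem : ∀ T, T ⊆ s → ∃ A ∈ C, ∀ j ∈ s, (z j ∈ A ↔ j ∈ T) := by
    intro T hT
    obtain ⟨u, hu, rfl⟩ := hs hT
    simp only [traces, Finset.mem_filter, Finset.mem_univ, true_and] at hu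
    obtain ⟨A, hA, hu⟩ := hu
    refine ⟨A, hA, fun j hj => ?_⟩
    have : j ∈ (u : Set J) ↔ z j ∈ A := by rw [hu]; rfl
    simp [hj, ← this]
  -- A sample may repeat points, but indices of equal points cannot be separated, so a shattered
  -- index set has distinct points.
  have hinj : Set.InjOn z s := by
    intro i hi j hj hij
    obtain ⟨A, _, hA⟩ := hmem {i} (by simpa using hi)
    have h1 := (hA i hi).2 (by simp)
    rw [hij] at h1
    exact (Finset.mem_singleton.1 ((hA j hj).1 h1)).symm
  have hsh : Shatters C (s.image z) := by
    intro T hT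
    obtain ⟨A, hAC, hA⟩ := hmem (s.filter fun j => z j ∈ T) (Finset.filter_subset _ _)
    refine ⟨A, hAC, ?_⟩
    ext x
    constructor
    · rintro ⟨hx, hxA⟩
      obtain ⟨j, hj, rfl⟩ := Finset.mem_image.1 (Finset.mem_coe.1 hx)
      exact (Finset.mem_filter.1 ((hA j hj).1 hxA)).2
    · intro hx
      obtain ⟨j, hj, rfl⟩ := Finset.mem_image.1 (hT hx)
      exact ⟨hT hx, (hA j hj).2 (Finset.mem_filter.2 ⟨hj, hx⟩)⟩
  have h1 : ((s.image z).card : ℕ∞) ≤ d :=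
    le_trans (le_iSup₂ (f := fun (S : Finset X) (_ : Shatters C S) => (S.card : ℕ∞)) _ hsh) hd
  rw [Finset.card_image_of_injOn hinj] at h1
  exact_mod_cast h1

theorem card_traces_le {J X : Type*} [Fintype J] {C : Set (Set X)} {d : ℕ}
    (hd : setVCDim C ≤ d) (z : J → X) :
    (traces C z).card ≤ ∑ k ∈ Finset.Iic d, (Fintype.card J).choose k := by
  classical
  refine (Finset.card_le_card_shatterer _).trans (Finset.card_shatterer_le_sum_vcDim.trans ?_)
  refine Finset.sum_le_sum_of_subset (Finset.Iic_subset_Iic.2 ?_)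
  exact Finset.sup_le fun s hs => card_le_of_traces_shatters hd z (Finset.mem_shatterer.1 hs)

/-- Weighting by (d/m)^d ≤ (d/m)^k for k ≤ d bounds the sum by the binomial expansion of (1 + d/m)^m
≤ e^d. -/
theorem sum_choose_le_exp {m d : ℕ} (hdm : d ≤ m) :
    ((∑ k ∈ Finset.Iic d, m.choose k : ℕ) : ℝ)
      ≤ Real.exp (d * Real.log (Real.exp 1 * m / d)) := by
  rcases Nat.eq_zero_or_pos d with rfl | hd
  · have : (Finset.Iic 0 : Finset ℕ) = {0} := by ext; simp
    simp [this]
  have hd' : (0 : ℝ) < d := by exact_mod_cast hd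
  have hm' : (0 : ℝ) < m := by exact_mod_cast hd.trans_le hdm
  have hq : (d : ℝ) / m ≤ 1 := by rw [div_le_one hm']; exact_mod_cast hdm
  have hq0 : (0 : ℝ) < d / m := by positivity
  rw [mul_comm, Real.exp_mul, Real.exp_log (by positivity), Real.rpow_natCast]
  have h1 : ((∑ k ∈ Finset.Iic d, m.choose k : ℕ) : ℝ) * ((d : ℝ) / m) ^ d ≤ Real.exp d := by
    calc _ = ∑ k ∈ Finset.Iic d, (m.choose k : ℝ) * ((d : ℝ) / m) ^ d := by
          push_cast; rw [Finset.sum_mul]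
      _ ≤ ∑ k ∈ Finset.Iic d, (m.choose k : ℝ) * ((d : ℝ) / m) ^ k := by
          refine Finset.sum_le_sum fun k hk => ?_
          exact mul_le_mul_of_nonneg_left
            (pow_le_pow_of_le_one hq0.le hq (Finset.mem_Iic.1 hk)) (by positivity)
      _ ≤ ∑ k ∈ Finset.range (m + 1), (m.choose k : ℝ) * ((d : ℝ) / m) ^ k := by
          refine Finset.sum_le_sum_of_subset_of_nonneg (fun k hk => ?_) fun _ _ _ => by positivity
          rw [Finset.mem_Iic] at hk
          rw [Finset.mem_range]; omega
      _ = ((d : ℝ) / m + 1) ^ m := by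
          rw [add_pow]; exact Finset.sum_congr rfl fun k _ => by simp [mul_comm]
      _ ≤ Real.exp ((d : ℝ) / m) ^ m :=
          pow_le_pow_left₀ (by positivity) (Real.add_one_le_exp _) _
      _ = Real.exp d := by rw [← Real.exp_nat_mul]; congr 1; field_simp
  have h2 : (Real.exp 1 * m / d) ^ d * ((d : ℝ) / m) ^ d = Real.exp d := by
    rw [← mul_pow, ← Real.exp_one_pow]; congr 1; field_simp
  rw [← h2] at h1
  exact le_of_mul_le_mul_right h1 (by positivity)

/-! ### Relabelling of coordinates and Jensen's inequality -/

theorem measurePreserving_comp_equiv {X : Type*} [MeasurableSpace X] (p : Measure X) [SigmaFinite p]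
    {ι ι' : Type*} [Fintype ι] [Fintype ι'] (e : ι' ≃ ι) :
    MeasurePreserving (fun z : ι → X => fun i => z (e i))
      (Measure.pi fun _ => p) (Measure.pi fun _ => p) := by
  have h := measurePreserving_piCongrLeft (α := fun _ : ι' => X) (fun _ => p) e.symm
  convert h using 1
  ext z i
  obtain ⟨j, rfl⟩ := e.symm.surjective i
  rw [MeasurableEquiv.piCongrLeft, MeasurableEquiv.coe_mk, Equiv.piCongrLeft_apply_apply]
  simp

theorem exp_integral_le_of_bounded {Y : Type*} [MeasurableSpace Y] (μ : Measure Y)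
    [IsProbabilityMeasure μ] {g : Y → ℝ} (hg : AEStronglyMeasurable g μ) {M : ℝ}
    (hM : ∀ y, |g y| ≤ M) : Real.exp (∫ y, g y ∂μ) ≤ ∫ y, Real.exp (g y) ∂μ := by
  refine convexOn_exp.map_integral_le Real.continuous_exp.continuousOn isClosed_univ
    (Filter.Eventually.of_forall fun _ => Set.mem_univ _)
    (Integrable.of_bound hg M (Filter.Eventually.of_forall hM)) ?_
  refine Integrable.of_bound (Real.continuous_exp.comp_aestronglyMeasurable hg) (Real.exp M)
    (Filter.Eventually.of_forall fun y => ?_)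
  simpa using (le_abs_self _).trans (hM y)

/-! ### Sign averages on a fixed double sample -/

/-- The supremum over a class of the absolute value of the signed sum of the differences between
the two halves of a double sample. -/
noncomputable def signedSup {X : Type*} (F : Set (X → ℝ)) {n : ℕ} (s : Fin n → Bool)
    (z : Fin n ⊕ Fin n → X) : ℝ :=
  ⨆ g : F, |∑ i, signOf (s i) * ((g : X → ℝ) (z (.inr i)) - (g : X → ℝ) (z (.inl i)))|

theorem abs_signOf (b : Bool) : |signOf b| = 1 := by cases b <;> simp [signOf]

theorem abs_sub_le_one_of_mem {a b : ℝ} (ha : a ∈ Set.Icc (0 : ℝ) 1) (hb : b ∈ Set.Icc (0 : ℝ) 1) :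
    |a - b| ≤ 1 := abs_le.2 ⟨by linarith [ha.1, hb.2], by linarith [ha.2, hb.1]⟩

theorem abs_signed_sum_le {n : ℕ} (s : Fin n → Bool) (a : Fin n → ℝ) (ha : ∀ i, |a i| ≤ 1) :
    |∑ i, signOf (s i) * a i| ≤ n := by
  refine (Finset.abs_sum_le_sum_abs _ _).trans ?_
  calc _ ≤ ∑ _i : Fin n, (1 : ℝ) :=
        Finset.sum_le_sum fun i _ => by rw [abs_mul, abs_signOf, one_mul]; exact ha i
    _ = n := by simp

theorem le_signedSup {X : Type*} {F : Set (X → ℝ)}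
    (hF : ∀ g ∈ F, ∀ x, g x ∈ Set.Icc (0 : ℝ) 1) {n : ℕ} {g : X → ℝ} (hg : g ∈ F)
    (s : Fin n → Bool) (z : Fin n ⊕ Fin n → X) :
    |∑ i, signOf (s i) * (g (z (.inr i)) - g (z (.inl i)))| ≤ signedSup F s z := by
  refine le_ciSup (f := fun g : F =>
    |∑ i, signOf (s i) * ((g : X → ℝ) (z (.inr i)) - (g : X → ℝ) (z (.inl i)))|) ⟨n, ?_⟩ ⟨g, hg⟩
  rintro _ ⟨g, rfl⟩
  exact abs_signed_sum_le s _ fun i => abs_sub_le_one_of_mem (hF _ g.2 _) (hF _ g.2 _)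

theorem abs_signedSup_le {X : Type*} {F : Set (X → ℝ)}
    (hF : ∀ g ∈ F, ∀ x, g x ∈ Set.Icc (0 : ℝ) 1) {n : ℕ} (s : Fin n → Bool)
    (z : Fin n ⊕ Fin n → X) : |signedSup F s z| ≤ n := by
  unfold signedSup
  rw [abs_of_nonneg (Real.iSup_nonneg fun _ => abs_nonneg _)]
  exact Real.iSup_le (fun g => abs_signed_sum_le s _ fun i =>
    abs_sub_le_one_of_mem (hF _ g.2 _) (hF _ g.2 _)) (Nat.cast_nonneg n)

theorem loss_mem_Icc {X : Type*} {h f : X → ℝ} {x : X} (hh : h x ∈ Set.Icc (0 : ℝ) 1)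
    (hf : f x ∈ Set.Icc (0 : ℝ) 1) : loss h f x ∈ Set.Icc (0 : ℝ) 1 :=
  ⟨abs_nonneg _, abs_sub_le_one_of_mem hh hf⟩

theorem exp_signed_loss_le_integral {X : Type*} {h f : X → ℝ} (hh : ∀ x, h x ∈ Set.Icc (0 : ℝ) 1)
    (hf : ∀ x, f x ∈ Set.Icc (0 : ℝ) 1) {n : ℕ} (s : Fin n → Bool) (z : Fin n ⊕ Fin n → X) (c : ℝ) :
    Real.exp (c * ∑ i, signOf (s i) * (loss h f (z (.inr i)) - loss h f (z (.inl i))))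
      ≤ ∫ t in Set.Ioo (0 : ℝ) 1, Real.exp (c * ∑ i, signOf (s i) *
          (|ind (t ≤ h (z (.inr i))) - ind (t ≤ f (z (.inr i)))|
            - |ind (t ≤ h (z (.inl i))) - ind (t ≤ f (z (.inl i)))|)) := by
  have : IsProbabilityMeasure (volume.restrict (Set.Ioo (0 : ℝ) 1)) := ⟨by simp⟩
  have hm : ∀ x, Measurable fun t : ℝ => |ind (t ≤ h x) - ind (t ≤ f x)| := fun x =>
    ((measurable_ind_le _).sub (measurable_ind_le _)).abs
  have hi : ∀ x, Integrable (fun t : ℝ => |ind (t ≤ h x) - ind (t ≤ f x)|)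
      (volume.restrict (Set.Ioo (0 : ℝ) 1)) := fun x =>
    Integrable.of_bound (hm x).aestronglyMeasurable 1 (Filter.Eventually.of_forall fun t => by
      rw [Real.norm_eq_abs, abs_abs]; exact (abs_ind_sub_mem _ _).2)
  have h1 : c * ∑ i, signOf (s i) * (loss h f (z (.inr i)) - loss h f (z (.inl i)))
      = ∫ t in Set.Ioo (0 : ℝ) 1, c * ∑ i, signOf (s i) *
          (|ind (t ≤ h (z (.inr i))) - ind (t ≤ f (z (.inr i)))|
            - |ind (t ≤ h (z (.inl i))) - ind (t ≤ f (z (.inl i)))|) := by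
    have hsub : ∀ i, Integrable (fun t : ℝ => signOf (s i) *
        (|ind (t ≤ h (z (.inr i))) - ind (t ≤ f (z (.inr i)))|
          - |ind (t ≤ h (z (.inl i))) - ind (t ≤ f (z (.inl i)))|))
        (volume.restrict (Set.Ioo (0 : ℝ) 1)) := fun i => ((hi _).sub (hi _)).const_mul _
    rw [integral_const_mul, integral_finsetSum _ fun i _ => hsub i]
    congr 1
    refine Finset.sum_congr rfl fun i _ => ?_
    rw [integral_const_mul, integral_sub (hi _) (hi _), loss, loss,
      abs_sub_eq_integral_ind (hh _) (hf _), abs_sub_eq_integral_ind (hh _) (hf _)]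
  rw [h1]
  refine exp_integral_le_of_bounded _ (M := |c| * n) (Measurable.aestronglyMeasurable ?_) fun t => ?_
  · exact (Finset.measurable_fun_sum _ fun i _ =>
      ((hm _).sub (hm _)).const_mul _).const_mul _
  · rw [abs_mul]
    exact mul_le_mul_of_nonneg_left (abs_signed_sum_le s _ fun i =>
      abs_sub_le_one_of_mem (abs_ind_sub_mem _ _) (abs_ind_sub_mem _ _)) (abs_nonneg _)

/-- The signed sum of the differences between the losses at level `t` on the two halves of a double
sample, for a classifier with trace `T`. -/
noncomputable def levelSum {X : Type*} (h : X → ℝ) {n : ℕ} (s : Fin n → Bool)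
    (z : Fin n ⊕ Fin n → X) (T : Finset (Fin n ⊕ Fin n)) (t : ℝ) : ℝ :=
  ∑ i, signOf (s i) * (|ind (t ≤ h (z (.inr i))) - ind (.inr i ∈ T)|
    - |ind (t ≤ h (z (.inl i))) - ind (.inl i ∈ T)|)

theorem integrable_exp_levelSum {X : Type*} (h : X → ℝ) {n : ℕ} (s : Fin n → Bool)
    (z : Fin n ⊕ Fin n → X) (T : Finset (Fin n ⊕ Fin n)) {r : ℝ} (hr : 0 ≤ r) :
    Integrable (fun t => Real.exp (r * |levelSum h s z T t|))
      (volume.restrict (Set.Ioo (0 : ℝ) 1)) := by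
  have hm : ∀ x p, Measurable fun t : ℝ => |ind (t ≤ h x) - ind p| := fun x p =>
    ((measurable_ind_le _).sub measurable_const).abs
  refine Integrable.of_bound (Measurable.aestronglyMeasurable ?_) (Real.exp (r * n))
    (Filter.Eventually.of_forall fun t => ?_)
  · exact ((Finset.measurable_fun_sum _ fun i _ =>
      ((hm _ _).sub (hm _ _)).const_mul _).abs.const_mul _).exp
  · rw [Real.norm_eq_abs, Real.abs_exp, Real.exp_le_exp]
    exact mul_le_mul_of_nonneg_left (abs_signed_sum_le s _ fun i =>
      abs_sub_le_one_of_mem (abs_ind_sub_mem _ _) (abs_ind_sub_mem _ _)) hr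

/-- The level sets of a class of functions, at levels between `0` and `1`. -/
def levelSets {X : Type*} (H : Set (X → ℝ)) : Set (Set X) :=
  {A | ∃ f ∈ H, ∃ t ∈ Set.Ioo (0 : ℝ) 1, A = {x | t ≤ f x}}

/-- A union bound inside the integral over t: at each level the trace of f is one of finitely many,
so the sum over traces dominates every f. The level sets of h need no complexity bound, since h is
fixed. -/
theorem sum_exp_signedSup_le {X : Type*} {h : X → ℝ} (hh : ∀ x, h x ∈ Set.Icc (0 : ℝ) 1)
    {H : Set (X → ℝ)} (hH : ∀ f ∈ H, ∀ x, f x ∈ Set.Icc (0 : ℝ) 1) (hne : H.Nonempty) {n : ℕ}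
    (z : Fin n ⊕ Fin n → X) {r : ℝ} (hr : 0 < r) :
    ∑ s : Fin n → Bool, Real.exp (r * signedSup ((fun f => loss h f) '' H) s z)
      ≤ (traces (levelSets H) z).card * (2 * (2 ^ n * Real.exp (n * (r ^ 2 / 2)))) := by
  have hint : ∀ s, Integrable (fun t => ∑ T ∈ traces (levelSets H) z,
      Real.exp (r * |levelSum h s z T t|)) (volume.restrict (Set.Ioo (0 : ℝ) 1)) := fun s =>
    integrable_finsetSum _ fun T _ => integrable_exp_levelSum h s z T hr.le
  have key : ∀ s : Fin n → Bool, ∀ f ∈ H, ∀ c, |c| = r →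
      Real.exp (c * ∑ i, signOf (s i) * (loss h f (z (.inr i)) - loss h f (z (.inl i))))
      ≤ ∫ t in Set.Ioo (0 : ℝ) 1, ∑ T ∈ traces (levelSets H) z,
          Real.exp (r * |levelSum h s z T t|) := by
    intro s f hf c hc
    refine (exp_signed_loss_le_integral hh (hH f hf) s z c).trans
      (integral_mono_of_nonneg (Filter.Eventually.of_forall fun t => (Real.exp_pos _).le)
        (hint s) ?_)
    refine (ae_restrict_iff' measurableSet_Ioo).2 (Filter.Eventually.of_forall fun t ht => ?_)
    classical
    let T : Finset (Fin n ⊕ Fin n) := Finset.univ.filter fun j => t ≤ f (z j)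
    have hT : T ∈ traces (levelSets H) z := by
      simp only [traces, Finset.mem_filter, Finset.mem_univ, true_and]
      exact ⟨{x | t ≤ f x}, ⟨f, hf, t, ht, rfl⟩, by ext j; simp [T]⟩
    refine le_trans ?_ (Finset.single_le_sum
      (f := fun T => Real.exp (r * |levelSum h s z T t|)) (fun _ _ => (Real.exp_pos _).le) hT)
    have hmem : ∀ j, (j ∈ T) = (t ≤ f (z j)) := fun j => by simp [T]
    simp only [levelSum, hmem]
    refine Real.exp_le_exp.2 ((le_abs_self _).trans ?_)
    rw [abs_mul, hc]
  have hsup : ∀ s : Fin n → Bool,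
      Real.exp (r * signedSup ((fun f => loss h f) '' H) s z)
      ≤ ∫ t in Set.Ioo (0 : ℝ) 1, ∑ T ∈ traces (levelSets H) z,
          Real.exp (r * |levelSum h s z T t|) := by
    intro s
    have : Nonempty ((fun f => loss h f) '' H) := (hne.image _).to_subtype
    set B := ∫ t in Set.Ioo (0 : ℝ) 1, ∑ T ∈ traces (levelSets H) z,
          Real.exp (r * |levelSum h s z T t|) with hB
    obtain ⟨f₀, hf₀⟩ := hne
    have hBpos : 0 < B := (Real.exp_pos _).trans_le (key s f₀ hf₀ r (abs_of_pos hr))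
    -- Passing to the logarithm turns the claim into an upper bound on the supremum itself, checked
    -- for each f.
    rw [← Real.le_log_iff_exp_le hBpos, mul_comm, ← le_div_iff₀ hr]
    refine ciSup_le ?_
    rintro ⟨_, f, hf, rfl⟩
    rw [le_div_iff₀ hr, mul_comm, Real.le_log_iff_exp_le hBpos]
    dsimp only
    rcases abs_choice (∑ i, signOf (s i) * (loss h f (z (.inr i)) - loss h f (z (.inl i))))
      with h1 | h1 <;> rw [h1]
    · exact key s f hf r (abs_of_pos hr)
    · rw [mul_neg, ← neg_mul]
      exact key s f hf (-r) (by rw [abs_neg, abs_of_pos hr])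
  have : IsProbabilityMeasure (volume.restrict (Set.Ioo (0 : ℝ) 1)) := ⟨by simp⟩
  calc _ ≤ ∑ s : Fin n → Bool, ∫ t in Set.Ioo (0 : ℝ) 1, ∑ T ∈ traces (levelSets H) z,
          Real.exp (r * |levelSum h s z T t|) := Finset.sum_le_sum fun s _ => hsup s
    _ = ∫ t in Set.Ioo (0 : ℝ) 1, ∑ s : Fin n → Bool, ∑ T ∈ traces (levelSets H) z,
          Real.exp (r * |levelSum h s z T t|) := (integral_finsetSum _ fun s _ => hint s).symm
    _ ≤ ∫ _t in Set.Ioo (0 : ℝ) 1,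
          (traces (levelSets H) z).card * (2 * (2 ^ n * Real.exp (n * (r ^ 2 / 2)))) := by
        refine integral_mono (integrable_finsetSum _ fun s _ => hint s) (integrable_const _)
          fun t => ?_
        dsimp only
        rw [Finset.sum_comm, ← nsmul_eq_mul]
        exact Finset.sum_le_card_nsmul _ _ _ fun T _ => sum_exp_abs_signs_le _ (fun i =>
          abs_sub_le_one_of_mem (abs_ind_sub_mem _ _) (abs_ind_sub_mem _ _)) r
    _ = _ := by simp

/-- A sign −1 at i amounts to exchanging the two i-th points. -/
theorem signedSup_comp_swap {X : Type*} (F : Set (X → ℝ)) {n : ℕ} (s : Fin n → Bool) :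
    ∃ e : Fin n ⊕ Fin n ≃ Fin n ⊕ Fin n, ∀ z : Fin n ⊕ Fin n → X,
      signedSup F s z = signedSup F (fun _ => true) fun j => z (e j) := by
  let φ : Fin n ⊕ Fin n → Fin n ⊕ Fin n :=
    Sum.elim (fun i => if s i then .inl i else .inr i) fun i => if s i then .inr i else .inl i
  have hφ : Function.Involutive φ := by
    rintro (i | i) <;> cases hs : s i <;> simp [φ, hs]
  refine ⟨hφ.toPerm, fun z => ?_⟩
  unfold signedSup
  congr 1
  ext g
  congr 1
  refine Finset.sum_congr rfl fun i _ => ?_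
  cases hs : s i <;> simp [φ, hs, signOf]

/-! ### Symmetrization and uniform deviation -/

section Integral

variable {X : Type*} [MeasurableSpace X] (p : Measure X) [IsProbabilityMeasure p]

theorem aemeasurable_signedSup {F : Set (X → ℝ)} (hF : IsMeasurableClass p F) (n : ℕ) :
    AEMeasurable (signedSup F fun _ : Fin n => true)
      (Measure.pi fun _ : Fin n ⊕ Fin n => p) := by
  have h1 := AEMeasurable.comp_quasiMeasurePreserving
    (hF.2 (n + n) (Fin.append (fun _ => -1) fun _ => 1))
    (measurePreserving_comp_equiv p finSumFinEquiv.symm).quasiMeasurePreserving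
  convert h1 using 1
  ext z
  unfold signedSup
  simp only [Function.comp_apply]
  congr 1
  ext g
  congr 1
  rw [Fin.sum_univ_add]
  simp [signOf, Finset.sum_sub_distrib, -Fin.natAdd_eq_addNat]
  ring

/-- By exchangeability all 2^n sign patterns have the same integral, so it equals their average,
which is bounded pointwise in z. -/
theorem integral_exp_signedSup_le {h : X → ℝ} (hh : ∀ x, h x ∈ Set.Icc (0 : ℝ) 1)
    {H : Set (X → ℝ)} (hH : ∀ f ∈ H, ∀ x, f x ∈ Set.Icc (0 : ℝ) 1) (hne : H.Nonempty)
    (hmeas : IsMeasurableClass p ((fun f => loss h f) '' H)) (n : ℕ) {N : ℝ}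
    (hN : ∀ z : Fin n ⊕ Fin n → X, ((traces (levelSets H) z).card : ℝ) ≤ N) {r : ℝ} (hr : 0 < r) :
    ∫ z, Real.exp (r * signedSup ((fun f => loss h f) '' H) (fun _ : Fin n => true) z)
      ∂(Measure.pi fun _ : Fin n ⊕ Fin n => p) ≤ N * (2 * Real.exp (n * (r ^ 2 / 2))) := by
  set F := (fun f => loss h f) '' H with hFdef
  have hF : ∀ g ∈ F, ∀ x, g x ∈ Set.Icc (0 : ℝ) 1 := by
    rintro _ ⟨f, hf, rfl⟩ x
    exact loss_mem_Icc (hh x) (hH f hf x)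
  set π := Measure.pi fun _ : Fin n ⊕ Fin n => p
  have hae := aemeasurable_signedSup p hmeas n
  have hs : ∀ s : Fin n → Bool, AEMeasurable (signedSup F s) π ∧
      ∫ z, Real.exp (r * signedSup F s z) ∂π
        = ∫ z, Real.exp (r * signedSup F (fun _ => true) z) ∂π := by
    intro s
    obtain ⟨e, he⟩ := signedSup_comp_swap F s
    have hmp := measurePreserving_comp_equiv p e
    refine ⟨?_, ?_⟩
    · have := hae.comp_quasiMeasurePreserving hmp.quasiMeasurePreserving
      exact this.congr (Filter.Eventually.of_forall fun z => (he z).symm)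
    · simp_rw [he]
      have h2 : AEStronglyMeasurable (fun z => Real.exp (r * signedSup F (fun _ => true) z))
          (Measure.map (fun (z : Fin n ⊕ Fin n → X) i => z (e i)) π) := by
        rw [hmp.map_eq]
        exact (hae.const_mul r).exp.aestronglyMeasurable
      have := integral_map hmp.measurable.aemeasurable h2
      rw [hmp.map_eq] at this
      exact this.symm
  have hint : ∀ s : Fin n → Bool, Integrable (fun z => Real.exp (r * signedSup F s z)) π := fun s =>
    Integrable.of_bound ((hs s).1.const_mul r).exp.aestronglyMeasurable (Real.exp (r * n))
      (Filter.Eventually.of_forall fun z => by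
        rw [Real.norm_eq_abs, Real.abs_exp, Real.exp_le_exp]
        exact mul_le_mul_of_nonneg_left ((le_abs_self _).trans (abs_signedSup_le hF s z)) hr.le)
  have hsum : (2 : ℝ) ^ n * ∫ z, Real.exp (r * signedSup F (fun _ => true) z) ∂π
      ≤ N * (2 * (2 ^ n * Real.exp (n * (r ^ 2 / 2)))) := by
    calc _ = ∑ s : Fin n → Bool, ∫ z, Real.exp (r * signedSup F s z) ∂π := by
          simp [fun s => (hs s).2]
      _ = ∫ z, ∑ s : Fin n → Bool, Real.exp (r * signedSup F s z) ∂π :=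
          (integral_finsetSum _ fun s _ => hint s).symm
      _ ≤ ∫ _z, N * (2 * (2 ^ n * Real.exp (n * (r ^ 2 / 2)))) ∂π :=
          integral_mono (integrable_finsetSum _ fun s _ => hint s) (integrable_const _) fun z =>
            (sum_exp_signedSup_le hh hH hne z hr).trans
              (mul_le_mul_of_nonneg_right (hN z) (by positivity))
      _ = _ := by simp
  refine le_of_mul_le_mul_left (hsum.trans (le_of_eq ?_)) (pow_pos two_pos n)
  ring

/-- Jensen over the ghost sample y, whose mean loss is the expected error. -/
theorem exp_expected_sub_empirical_le {h f : X → ℝ} (hh : ∀ x, h x ∈ Set.Icc (0 : ℝ) 1)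
    (hhm : Measurable h) (hf : ∀ x, f x ∈ Set.Icc (0 : ℝ) 1) (hfm : Measurable f) {n : ℕ}
    (hn : 1 ≤ n) (x : Fin n → X) (r : ℝ) :
    Real.exp (r * (n * (expectedError p h f - empiricalError h f x)))
      ≤ ∫ y, Real.exp (r * ∑ i, (loss h f (y i) - loss h f (x i)))
          ∂(Measure.pi fun _ : Fin n => p) := by
  have hlm : Measurable (loss h f) := (hhm.sub hfm).abs
  have hl : ∀ x, loss h f x ∈ Set.Icc (0 : ℝ) 1 := fun x => loss_mem_Icc (hh x) (hf x)
  have hi : Integrable (loss h f) p := Integrable.of_bound hlm.aestronglyMeasurable 1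
    (Filter.Eventually.of_forall fun y => by
      rw [Real.norm_eq_abs, abs_of_nonneg (hl y).1]; exact (hl y).2)
  have hy : ∀ i : Fin n, Integrable (fun y : Fin n → X => loss h f (y i))
      (Measure.pi fun _ : Fin n => p) := fun i =>
    (measurePreserving_eval (fun _ : Fin n => p) i).integrable_comp_of_integrable hi
  have hyi : ∀ i : Fin n, ∫ y : Fin n → X, loss h f (y i) ∂(Measure.pi fun _ : Fin n => p)
      = expectedError p h f := fun i => by
    have hmp := measurePreserving_eval (fun _ : Fin n => p) i
    have := integral_map (μ := Measure.pi fun _ : Fin n => p) hmp.measurable.aemeasurable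
      (f := loss h f) hlm.aestronglyMeasurable
    rw [hmp.map_eq] at this
    exact this.symm
  have h1 : r * (n * (expectedError p h f - empiricalError h f x))
      = ∫ y, r * ∑ i, (loss h f (y i) - loss h f (x i)) ∂(Measure.pi fun _ : Fin n => p) := by
    have hsub : ∀ i, Integrable (fun y : Fin n → X => loss h f (y i) - loss h f (x i))
        (Measure.pi fun _ : Fin n => p) := fun i => (hy i).sub (integrable_const _)
    rw [integral_const_mul, integral_finsetSum _ fun i _ => hsub i]
    simp_rw [integral_sub (hy _) (integrable_const _), hyi]
    have hn' : (n : ℝ) ≠ 0 := by positivity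
    simp only [integral_const, probReal_univ, smul_eq_mul, one_mul, Finset.sum_sub_distrib,
      Finset.sum_const, Finset.card_univ, Fintype.card_fin, nsmul_eq_mul, empiricalError]
    field_simp
  rw [h1]
  refine exp_integral_le_of_bounded _ (M := |r| * n) (Measurable.aestronglyMeasurable ?_) fun y => ?_
  · exact (Finset.measurable_fun_sum _ fun i _ =>
      (hlm.comp (measurable_pi_apply i)).sub measurable_const).const_mul _
  · rw [abs_mul]
    refine mul_le_mul_of_nonneg_left ?_ (abs_nonneg _)
    have := abs_signed_sum_le (fun _ => true) (fun i => loss h f (y i) - loss h f (x i))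
      fun i => abs_sub_le_one_of_mem (hl _) (hl _)
    simpa [signOf] using this

/-- Uniform convergence of the empirical errors, for a class whose level sets have at most `N`
traces on every double sample. -/
theorem exists_uniform_bound {h : X → ℝ} (hh : ∀ x, h x ∈ Set.Icc (0 : ℝ) 1) (hhm : Measurable h)
    {H : Set (X → ℝ)} (hH : ∀ f ∈ H, ∀ x, f x ∈ Set.Icc (0 : ℝ) 1) (hHm : ∀ f ∈ H, Measurable f)
    (hne : H.Nonempty) (hmeas : IsMeasurableClass p ((fun f => loss h f) '' H)) {n : ℕ} (hn : 1 ≤ n)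
    {N : ℝ} (hN : ∀ z : Fin n ⊕ Fin n → X, ((traces (levelSets H) z).card : ℝ) ≤ N)
    {r δ : ℝ} (hr : 0 < r) (hδ : 0 < δ) (hrδ : 2 * N / δ ≤ Real.exp (n * (r ^ 2 / 2))) :
    ∃ G : Set (Fin n → X), MeasurableSet G ∧ 1 - δ ≤ (Measure.pi fun _ : Fin n => p).real G ∧
      ∀ x ∈ G, ∀ f ∈ H, expectedError p h f ≤ empiricalError h f x + r := by
  set F := (fun f => loss h f) '' H with hFdef
  have hF : ∀ g ∈ F, ∀ x, g x ∈ Set.Icc (0 : ℝ) 1 := by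
    rintro _ ⟨f, hf, rfl⟩ x
    exact loss_mem_Icc (hh x) (hH f hf x)
  set μ := Measure.pi fun _ : Fin n => p with hμ
  have hmp := measurePreserving_sumPiEquivProdPi_symm (X := fun _ : Fin n ⊕ Fin n => X) fun _ => p
  have hB := integral_exp_signedSup_le p hh hH hne hmeas n hN hr
  have hae := aemeasurable_signedSup p hmeas n
  rw [← hmp.integral_comp'] at hB
  have hae2 := hae.comp_quasiMeasurePreserving hmp.quasiMeasurePreserving
  set Φ : (Fin n → X) × (Fin n → X) → ℝ := fun q => Real.exp (r * signedSup F (fun _ => true)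
    ((MeasurableEquiv.sumPiEquivProdPi fun _ : Fin n ⊕ Fin n => X).symm q)) with hΦ
  have hint : Integrable Φ (μ.prod μ) :=
    Integrable.of_bound (hae2.const_mul r).exp.aestronglyMeasurable (Real.exp (r * n))
      (Filter.Eventually.of_forall fun z => by
        rw [Real.norm_eq_abs, Real.abs_exp, Real.exp_le_exp]
        exact mul_le_mul_of_nonneg_left ((le_abs_self _).trans (abs_signedSup_le hF _ _)) hr.le)
  have hQint : Integrable (fun x => ∫ y, Φ (x, y) ∂μ) μ := hint.integral_prod_left
  have hBQ : ∫ x, ∫ y, Φ (x, y) ∂μ ∂μ ≤ N * (2 * Real.exp (n * (r ^ 2 / 2))) := by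
    rw [← integral_prod _ hint]; exact hB
  set E := Real.exp (n * (r ^ 2 / 2)) with hE
  have hE0 : 0 < E := Real.exp_pos _
  -- The level is E² = exp(nr²) while the mean is at most 2NE, so the bad event has probability at
  -- most 2N/E ≤ δ.
  have hmarkov := mul_meas_ge_le_integral_of_nonneg
    (Filter.Eventually.of_forall fun x => integral_nonneg fun y => (Real.exp_pos _).le)
    hQint (E * E)
  have hbad : μ.real {x | E * E ≤ ∫ y, Φ (x, y) ∂μ} ≤ δ := by
    have h1 := hmarkov.trans hBQ
    rw [div_le_iff₀ hδ] at hrδ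
    have h2 : E * E * μ.real {x | E * E ≤ ∫ y, Φ (x, y) ∂μ} ≤ E * E * δ := by
      refine h1.trans ?_
      nlinarith
    exact le_of_mul_le_mul_left h2 (mul_pos hE0 hE0)
  have hgood : ∀ᵐ x ∂μ, Integrable (fun y => Φ (x, y)) μ := hint.prod_right_ae
  -- Where the section is not integrable its Bochner integral is 0 and bounds nothing; this null set
  -- is discarded too.
  set bad := {x | E * E ≤ ∫ y, Φ (x, y) ∂μ} ∪ {x | ¬ Integrable (fun y => Φ (x, y)) μ} with hbadd
  have hbad' : μ bad ≤ ENNReal.ofReal δ := by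
    refine (measure_union_le _ _).trans ?_
    rw [show μ {x | ¬ Integrable (fun y => Φ (x, y)) μ} = 0 from hgood, add_zero]
    rw [← ENNReal.ofReal_toReal (measure_ne_top μ _)]
    exact ENNReal.ofReal_le_ofReal hbad
  refine ⟨(toMeasurable μ bad)ᶜ, (measurableSet_toMeasurable _ _).compl, ?_, ?_⟩
  · rw [probReal_compl_eq_one_sub (measurableSet_toMeasurable _ _), measureReal_def,
      measure_toMeasurable]
    have := ENNReal.toReal_le_of_le_ofReal hδ.le hbad'
    linarith
  · intro x hx f hf
    have hxb : x ∉ bad := fun hb => hx (subset_toMeasurable _ _ hb)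
    simp only [hbadd, Set.mem_union, Set.mem_ofPred_eq, not_or, not_le, not_not] at hxb
    obtain ⟨hx1, hx2⟩ := hxb
    have h1 := exp_expected_sub_empirical_le p hh hhm (hH f hf) (hHm f hf) hn x r
    have h2 : ∫ y, Real.exp (r * ∑ i, (loss h f (y i) - loss h f (x i))) ∂μ ≤ ∫ y, Φ (x, y) ∂μ := by
      refine integral_mono_of_nonneg
        (Filter.Eventually.of_forall fun y => (Real.exp_pos _).le) hx2
        (Filter.Eventually.of_forall fun y => ?_)
      refine Real.exp_le_exp.2 (mul_le_mul_of_nonneg_left ?_ hr.le)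
      have h3 := le_signedSup hF (Set.mem_image_of_mem _ hf) (fun _ : Fin n => true)
        ((MeasurableEquiv.sumPiEquivProdPi fun _ : Fin n ⊕ Fin n => X).symm (x, y))
      refine le_trans (le_of_eq ?_) ((le_abs_self _).trans h3)
      simp only [signOf, if_true, one_mul]
      rfl
    have h3 := (h1.trans h2).trans_lt hx1
    rw [hE, ← Real.exp_add, Real.exp_lt_exp] at h3
    have hn' : (0 : ℝ) < n := by exact_mod_cast hn
    -- The exponential parameter equals the deviation r, so rn(e_s − ê_s) < nr² gives exactly r.
    have h4 : (r * n) * (expectedError p h f - empiricalError h f x) < (r * n) * r := by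
      linarith
    have := lt_of_mul_lt_mul_left h4 (by positivity)
    linarith

end Integral

end TransferBound

/-! ### The transfer bound -/

theorem theorem2 {X : Type*} [MeasurableSpace X]
    -- the source and target distributions
    (ps pt : Measure X) [IsProbabilityMeasure ps] [IsProbabilityMeasure pt]
    -- the true labeling function
    (h : X → ℝ) (hh : Measurable h) (hh01 : ∀ x, h x ∈ Set.Icc (0 : ℝ) 1)
    -- the hypothesis class and its VC dimension
    (H : Set (X → ℝ)) (hH : ∀ f ∈ H, Measurable f) (hH01 : ∀ f ∈ H, ∀ x, f x ∈ Set.Icc (0 : ℝ) 1)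
    (hmeas : TransferBound.IsMeasurableClass ps ((fun f => TransferBound.loss h f) '' H))
    (d : ℕ) (hd : TransferBound.vcDim H = (d : ℕ∞))
    -- the sample size and the confidence parameter
    (n : ℕ) (hn : 1 ≤ n) (hdn : d ≤ 2 * n) (δ : ℝ) (hδ : δ ∈ Set.Ioo (0 : ℝ) 1) :
    -- an event of probability at least `1 - δ` for an i.i.d. source sample of size `n`,
    -- on which the bound holds for all hypotheses at once
    ∃ G : Set (Fin n → X), MeasurableSet G ∧
      1 - δ ≤ (Measure.pi fun _ : Fin n => ps).real G ∧
      ∀ x ∈ G, ∀ f ∈ H,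
        TransferBound.expectedError pt h f ≤
          TransferBound.empiricalError h f x
            + Real.sqrt ((4 / (n : ℝ)) *
                ((d : ℝ) * Real.log (2 * Real.exp 1 * (n : ℝ) / (d : ℝ)) + Real.log (4 / δ)))
            + TransferBound.discrepancy ps pt h f
            + TransferBound.combinedError ps pt h H := by
  open TransferBound in
  obtain ⟨hδ0, hδ1⟩ := hδ
  rcases H.eq_empty_or_nonempty with rfl | hne
  · exact ⟨Set.univ, MeasurableSet.univ, by simp [hδ0.le], by simp⟩
  have hn0 : (0 : ℝ) < n := by exact_mod_cast hn
  set L : ℝ := (d : ℝ) * Real.log (2 * Real.exp 1 * (n : ℝ) / (d : ℝ)) with hL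
  have hLeq : L = d * Real.log (Real.exp 1 * (2 * n : ℕ) / d) := by
    rw [hL]; congr 3; push_cast; ring
  have hS := sum_choose_le_exp hdn
  rw [← hLeq] at hS
  have hN : ∀ z : Fin n ⊕ Fin n → X, ((traces (levelSets H) z).card : ℝ) ≤ Real.exp L := by
    intro z
    have h1 := card_traces_le (C := levelSets H) (d := d) hd.le z
    rw [Fintype.card_sum, Fintype.card_fin, ← two_mul] at h1
    exact (Nat.cast_le.2 h1).trans hS
  have hL1 : 1 ≤ Real.exp L := by
    refine le_trans ?_ hS
    have : (2 * n).choose 0 ≤ ∑ k ∈ Finset.Iic d, (2 * n).choose k :=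
      Finset.single_le_sum (f := fun k => (2 * n).choose k) (fun _ _ => Nat.zero_le _) (by simp)
    rw [Nat.choose_zero_right] at this
    exact_mod_cast this
  have hlog : 0 < Real.log (4 / δ) := Real.log_pos (by rw [lt_div_iff₀ hδ0]; linarith)
  have hL0 : 0 ≤ L := Real.one_le_exp_iff.1 hL1
  have hpos : 0 < 4 / (n : ℝ) * (L + Real.log (4 / δ)) := by positivity
  -- With this r, exp(nr²/2) is the square of e^L · 4/δ ≥ 1, more than the required 2e^L/δ.
  obtain ⟨G, hG, hGp, hGb⟩ := exists_uniform_bound ps hh01 hh hH01 hH hne hmeas hn hN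
    (Real.sqrt_pos.2 hpos) hδ0 (by
      rw [Real.sq_sqrt hpos.le]
      have h1 : (n : ℝ) * (4 / n * (L + Real.log (4 / δ)) / 2)
          = (L + Real.log (4 / δ)) + (L + Real.log (4 / δ)) := by field_simp; ring
      rw [h1, Real.exp_add, Real.exp_add, Real.exp_log (by positivity)]
      have h2 : 1 ≤ 4 / δ := by rw [le_div_iff₀ hδ0]; linarith
      have h3 : 1 ≤ Real.exp L * (4 / δ) := one_le_mul_of_one_le_of_one_le hL1 h2
      calc 2 * Real.exp L / δ ≤ Real.exp L * (4 / δ) := by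
            rw [mul_div_assoc', mul_comm]; gcongr; norm_num
        _ ≤ _ := le_mul_of_one_le_right (by positivity) h3)
  refine ⟨G, hG, hGp, fun x hx f hf => ?_⟩
  have h1 := hGb x hx f hf
  have h2 : 0 ≤ combinedError ps pt h H := Real.iInf_nonneg fun f =>
    add_nonneg (integral_nonneg fun _ => abs_nonneg _) (integral_nonneg fun _ => abs_nonneg _)
  have h3 : discrepancy ps pt h f = expectedError pt h f - expectedError ps h f := rfl
  rw [h3]
  linarith
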